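/- Let $M/F$ be a field extension of degree $n$ whose automorphism group $G=\mathrm{Aut}_F(M)$ is non-trivial and solvable, and let $A$ be a (finite-dimensional) central simple algebra of degree $n$ over $F$ that contains $M$ (so that $M$ is a maximal subfield of $A$). For a subgroup $H\le G$ let $\mathrm{Fix}(H)\subseteq M$ be its fixed field and let $M(H)$ be the centralizer of $\mathrm{Fix}(H)$ in $A$. A subalgebra $B\supseteq M$ of $A$ is called an $H$-crossed product algebra over $\mathrm{Fix}(H)$ if $B$ is central simple over $\mathrm{Fix}(H)$ of degree $[M:\mathrm{Fix}(H)]$ and $M/\mathrm{Fix}(H)$ is Galois with Galois group $H$. Then $G$ has a chain of subgroups $$\{1\}=G_0<G_1<\dots<G_k=G$$ with $G_i$ normal in $G_{i+1}$ and $G_{i+1}/G_i$ cyclic of prime order $q_i$ for $0\le i<k$. Moreover, for every such chain and all elements $\sigma_{i+1}\in G_{i+1}$ whose cosets generate $G_{i+1}/G_i$, there is a chain of $F$-subalgebras $$M=A_0\subset A_1\subset\dots\subset A_k=M(G)\subseteq A$$ (with strict inclusions $A_i\subset A_{i+1}$) such that $A_i$ is a $G_i$-crossed product algebra over $\mathrm{Fix}(G_i)$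 for $0\le i\le k$, and such that for each $0\le i<k$ there are an $F$-automorphism $\tau_i$ of $A_i$ and a unit $c_i$ of $A_i$ with the following properties: (i) $\tau_i$ has inner order $q_i$, that is, $q_i$ is the smallest positive integer $m$ for which $\tau_i^m$ is an inner automorphism $x\mapsto uxu^{-1}$ of $A_i$; (ii) $\tau_i$ restricts to $\sigma_{i+1}$ on $M$; (iii) $\tau_i(c_i)=c_i$; (iv) the left ideal $A_i[t;\tau_i](t^{q_i}-c_i)$ of the skew polynomial ring $A_i[t;\tau_i]$ (in which $ta=\tau_i(a)t$) is two-sided, and there is an isomorphism of $F$-algebras $$A_{i+1}\cong A_i[t;\tau_i]/A_i[t;\tau_i](t^{q_i}-c_i).$$ -/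

import Mathlib

/-- `B` is a (finite-dimensional) central simple algebra of degree `n` over the field `K`. -/
structure IsCentralSimpleOfDegree (K B : Type*) [Field K] [Ring B] [Algebra K B] (n : ℕ) :
    Prop where
  central : Algebra.IsCentral K B
  simple : IsSimpleRing B
  finite : FiniteDimensional K B
  finrank_eq : Module.finrank K B = n ^ 2

/-- The `K`-algebra `B` is a `G`-crossed product algebra over `K`, exhibited by the embedding
`j : L → B` of the field `L`: the algebra `B` is central simple over `K` of degree `[L : K]`, and
`L / K` is a Galois extension with Galois group `G`. -/
structure IsCrossedProductAlgebra (G : Type*) {K L B : Type*} [Group G] [Field K] [Field L]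
    [Ring B] [Algebra K L] [Algebra K B] [MulSemiringAction G L] (j : L →ₐ[K] B) : Prop where
  centralSimple : IsCentralSimpleOfDegree K B (Module.finrank K L)
  isGalois : IsGalois K L
  galoisGroup : IsGaloisGroup G K L

section Subalgebras

variable {F M A : Type*} [Field F] [Field M] [Algebra F M] [Ring A] [Algebra F A]

/-- Let `ι : M → A` embed the field `M` in `A` and let `H` be a group of `F`-automorphisms of `M`.
If the subalgebra `B` of `A` contains `M`, and `Fix(H)` centralizes `B`, then `B` is an algebra
over `Fix(H)` through `ι`. -/
@[reducible]
def algebraOverFix (ι : M →ₐ[F] A) (H : Subgroup (M ≃ₐ[F] M)) (B : Subalgebra F A)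
    (hM : ∀ m : M, ι m ∈ B)
    (hZ : ∀ z ∈ IntermediateField.fixedField H, ∀ b ∈ B, ι z * b = b * ι z) :
    Algebra (IntermediateField.fixedField H) B :=
  ((ι.codRestrict B hM).toRingHom.comp
    (algebraMap (IntermediateField.fixedField H) M)).toAlgebra'
      (fun z b => Subtype.ext (hZ z.1 z.2 b.1 b.2))

/-- The subalgebra `B` of `A` contains `M` (embedded by `ι : M → A`), is an algebra over the fixed
field `Fix(H)` of `H`, and is an `H`-crossed product algebra over `Fix(H)` with respect to `M`. -/
def IsCrossedProductOverFix (ι : M →ₐ[F] A) (H : Subgroup (M ≃ₐ[F] M)) (B : Subalgebra F A) :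
    Prop :=
  ∃ (hM : ∀ m : M, ι m ∈ B)
    (hZ : ∀ z ∈ IntermediateField.fixedField H, ∀ b ∈ B, ι z * b = b * ι z),
    letI : Algebra (IntermediateField.fixedField H) B := algebraOverFix ι H B hM hZ
    IsCrossedProductAlgebra H (K := IntermediateField.fixedField H) (L := M) (B := B)
      { (ι.codRestrict B hM).toRingHom with commutes' := fun _ => rfl }

/-- `M(H)`, the centralizer in `A` of the fixed field `Fix(H) ⊆ M` of `H`. -/
def crossedSubalgebra (ι : M →ₐ[F] A) (H : Subgroup (M ≃ₐ[F] M)) : Subalgebra F A :=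
  Subalgebra.centralizer F (ι '' (IntermediateField.fixedField H : Set M))

end Subalgebras

/-- A chain `1 = H 0 < H 1 < ... < H k = G` of subgroups, each normal in the next one, with cyclic
factor groups `H (i + 1) / H i` of prime order. -/
structure PrimeSeries (G : Type*) [Group G] (k : ℕ) where
  H : Fin (k + 1) → Subgroup G
  bot : H 0 = ⊥
  top : H (Fin.last k) = ⊤
  lt_succ : ∀ i : Fin k, H i.castSucc < H i.succ
  normal : ∀ i : Fin k, ((H i.castSucc).subgroupOf (H i.succ)).Normal
  cyclic : ∀ i : Fin k, IsCyclic (H i.succ ⧸ (H i.castSucc).subgroupOf (H i.succ))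
  prime : ∀ i : Fin k, (Nat.card (H i.succ ⧸ (H i.castSucc).subgroupOf (H i.succ))).Prime

namespace PrimeSeries

variable {G : Type*} [Group G] {k : ℕ}

/-- The factor group `H (i + 1) / H i`. -/
abbrev Factor (S : PrimeSeries G k) (i : Fin k) : Type _ :=
  S.H i.succ ⧸ (S.H i.castSucc).subgroupOf (S.H i.succ)

instance (S : PrimeSeries G k) (i : Fin k) :
    ((S.H i.castSucc).subgroupOf (S.H i.succ)).Normal := S.normal i

/-- The (prime) order `q i` of the factor group `H (i + 1) / H i`. -/
noncomputable def q (S : PrimeSeries G k) (i : Fin k) : ℕ := Nat.card (S.Factor i)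

/-- The coset of `s ∈ H (i + 1)` generates the factor group `H (i + 1) / H i`. -/
def Generates (S : PrimeSeries G k) (i : Fin k) (s : S.H i.succ) : Prop :=
  Subgroup.zpowers (QuotientGroup.mk s : S.Factor i) = ⊤

end PrimeSeries

section SkewPolynomials

variable {F B : Type*} [Field F] [Ring B] [Algebra F B]

/-- The automorphism `τ` of `B` has inner order `n`: `n` is the smallest positive integer such that
`τ ^ n` is an inner automorphism `x ↦ u x u⁻¹`. -/
def HasInnerOrder (τ : B ≃ₐ[F] B) (n : ℕ) : Prop :=
  IsLeast {m : ℕ | 0 < m ∧ ∃ u : Bˣ, ∀ x : B, (τ ^ m) x = u * x * (u⁻¹ : Bˣ)} n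

/-- A copy of the algebra `B` on which the natural number `n` acts by `τ ^ n`, so that
`SkewPolynomial (Twist τ)` is the skew polynomial ring `B[t; τ]`, with `t b = τ(b) t`. -/
def Twist (_τ : B ≃ₐ[F] B) : Type _ := B

variable (τ : B ≃ₐ[F] B)

instance : Ring (Twist τ) := inferInstanceAs (Ring B)

instance : Algebra F (Twist τ) := inferInstanceAs (Algebra F B)

/-- The identity map from `B` to its copy `Twist τ`. -/
def Twist.of : B ≃ₐ[F] Twist τ := (AlgEquiv.refl : B ≃ₐ[F] B)

instance : MulSemiringAction (Multiplicative ℕ) (Twist τ) where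
  smul n b := (τ ^ n.toAdd) b
  one_smul _ := rfl
  mul_smul m n b := by
    change (τ ^ (m.toAdd + n.toAdd)) b = (τ ^ m.toAdd) ((τ ^ n.toAdd) b)
    rw [pow_add]; rfl
  smul_zero n := map_zero (τ ^ n.toAdd)
  smul_add n := map_add (τ ^ n.toAdd)
  smul_one n := map_one (τ ^ n.toAdd)
  smul_mul n := map_mul (τ ^ n.toAdd)

instance : SMulCommClass (Multiplicative ℕ) F (Twist τ) where
  smul_comm n a b := map_smul (τ ^ n.toAdd) a b

/-- The left ideal `B[t; τ] (t ^ q - c)` of the skew polynomial ring `B[t; τ]`. -/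
noncomputable def cyclicIdeal (q : ℕ) (c : B) : Ideal (SkewPolynomial (Twist τ)) :=
  Ideal.span {(SkewPolynomial.X ^ q - SkewPolynomial.C (Twist.of τ c) :
    SkewPolynomial (Twist τ))}

/-- `t ^ q - c` is right invariant in `B[t; τ]`, and the `F`-algebra `B'` is isomorphic to
the quotient algebra `B[t; τ] / B[t; τ] (t ^ q - c)`. -/
def IsCyclicExtension (B' : Type*) [Ring B'] [Algebra F B'] (q : ℕ) (c : B) : Prop :=
  ∃ _ : (cyclicIdeal τ q c).IsTwoSided,
    Nonempty (B' ≃ₐ[F] (SkewPolynomial (Twist τ) ⧸ cyclicIdeal τ q c))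

end SkewPolynomials

/-! Take A_i = M(G_i), the centralizer of Fix(G_i); the tower is thus fixed by the subgroup chain,
and only τ_i and c_i depend on the chosen σ_{i+1}.

Two facts control M(H). The double-centralizer dimension count, with [M : Fix(H)] = |H|, gives dim
M(H) = |H|·n. By Skolem–Noether each σ in G is induced on M by a unit u_σ of A, and u_σ lies in M(H)
when σ is in H. Dedekind independence makes the u_σ with σ in H independent over M, so by the count
M(H) = ⊕ M u_σ. Simplicity and the centre Fix(H) follow.

For a step H < H' with s generating H'/H of order q, let u induce s. Since s normalizes H,
conjugation by u preserves M(H); this is τ, and c = u^q lies in M(H) because s^q is in H. The powers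
1, u, ..., u^(q-1) form a left M(H)-basis of M(H'): they are independent because the powers of s
differ on Fix(H), and they span because every element of H' is some h s^k. Sending t to u then
presents M(H') as the skew polynomial quotient.

The main lemmas are `finrank_centralizer_mul_finrank`, `exists_unit_conj_eq`,
`mem_of_sum_mem_of_distinct_characters` and `isCyclicExtension_of_unique_sum`. Solvability enters
only in the existence of the chain. -/

/-! ### Two-sided multiplication maps and the dimension of centralizers. -/

section CentralSimple

variable {F A : Type*} [Field F] [Ring A] [Algebra F A]

/-- In a central simple algebra, a relation `∑ aᵢ x bᵢ = 0`, valid for all `x`, with linearly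
independent `bᵢ` forces all `aᵢ` to vanish. -/
theorem eq_zero_of_forall_sum_mul_mul_eq_zero [Algebra.IsCentral F A] [IsSimpleRing A]
    {I : Type*} {b : I → A} (hb : LinearIndependent F b) (s : Finset I) (a : I → A)
    (h : ∀ x, ∑ i ∈ s, a i * x * b i = 0) : ∀ i ∈ s, a i = 0 := by
  classical
  induction s using Finset.induction_on generalizing a with
  | empty => simp
  | insert j s hj ih =>
    suffices haj : a j = 0 by
      intro i hi
      rcases Finset.mem_insert.1 hi with rfl | hi
      · exact haj
      · refine ih a (fun x => ?_) i hi
        simpa [Finset.sum_insert hj, haj] using h x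
    by_contra haj
    -- The possible `j`-th coefficients of relations form a two-sided ideal, so by simplicity a
    -- relation with `j`-th coefficient 1 exists.
    let J : TwoSidedIdeal A := TwoSidedIdeal.mk'
      {y | ∃ a' : I → A, a' j = y ∧ ∀ x, ∑ i ∈ insert j s, a' i * x * b i = 0}
      ⟨0, rfl, by simp⟩
      (by
        rintro _ _ ⟨a₁, rfl, h₁⟩ ⟨a₂, rfl, h₂⟩
        refine ⟨a₁ + a₂, rfl, fun x => ?_⟩
        simp only [Pi.add_apply, add_mul, Finset.sum_add_distrib, h₁, h₂, add_zero])
      (by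
        rintro _ ⟨a₁, rfl, h₁⟩
        refine ⟨-a₁, rfl, fun x => ?_⟩
        simp only [Pi.neg_apply, neg_mul, Finset.sum_neg_distrib, h₁, neg_zero])
      (by
        rintro y _ ⟨a₁, rfl, h₁⟩
        refine ⟨fun i => y * a₁ i, rfl, fun x => ?_⟩
        simp only [mul_assoc, ← Finset.mul_sum]
        simp only [← mul_assoc, h₁, mul_zero])
      (by
        rintro _ y ⟨a₁, rfl, h₁⟩
        refine ⟨fun i => a₁ i * y, rfl, fun x => ?_⟩
        simpa only [mul_assoc] using h₁ (y * x))
    have hJ : ∀ y, y ∈ J ↔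
        ∃ a' : I → A, a' j = y ∧ ∀ x, ∑ i ∈ insert j s, a' i * x * b i = 0 := fun y => by
      rw [TwoSidedIdeal.mem_mk']
      rfl
    have hJtop : J = ⊤ := by
      refine (eq_bot_or_eq_top J).resolve_left fun hbot => haj ?_
      have : a j ∈ J := (hJ _).2 ⟨a, rfl, h⟩
      rwa [hbot, TwoSidedIdeal.mem_bot] at this
    obtain ⟨a', ha', h'⟩ := (hJ 1).1 (hJtop ▸ trivial)
    -- Subtracting `y` times the relation at `x` from the relation at `y * x` cancels the `j`-th
    -- term. By induction the other coefficients commute with every `y`, hence are scalars, and `x =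
    -- 1` contradicts the independence of `b`.
    have hc : ∀ i ∈ s, ∃ f : F, a' i = algebraMap F A f := by
      intro i hi
      refine (Algebra.IsCentral.mem_center_iff F).1 (Subalgebra.mem_center_iff.2 fun y => ?_)
      refine sub_eq_zero.1 (ih (fun i => y * a' i - a' i * y) (fun x => ?_) i hi)
      have h₁ := h' x
      have h₂ := h' (y * x)
      rw [Finset.sum_insert hj, ha', one_mul] at h₁ h₂
      simp only [sub_mul, Finset.sum_sub_distrib, mul_assoc, ← Finset.mul_sum] at h₁ h₂ ⊢
      rw [eq_neg_of_add_eq_zero_right h₁, eq_neg_of_add_eq_zero_right h₂]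
      simp
    choose! f hf using hc
    have hsum := h' 1
    rw [Finset.sum_insert hj, ha'] at hsum
    have hlin : ∑ i ∈ insert j s, (if i = j then 1 else f i) • b i = 0 := by
      rw [Finset.sum_insert hj, if_pos rfl]
      rw [← hsum]
      simp only [one_smul, mul_one, one_mul]
      congr 1
      refine Finset.sum_congr rfl fun i hi => ?_
      rw [if_neg (ne_of_mem_of_not_mem hi hj), Algebra.smul_def, hf i hi]
    have := linearIndependent_iff'.1 hb _ _ hlin j (Finset.mem_insert_self j s)
    simp at this

/-- The `F`-linear map `x ↦ ∑ aᵢ x bᵢ`, depending linearly on the family `a`. -/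
def sumMulMul {I : Type*} [Fintype I] (b : I → A) : (I → A) →ₗ[F] Module.End F A where
  toFun a :=
    { toFun := fun x => ∑ i, a i * x * b i
      map_add' := fun x y => by simp only [mul_add, add_mul, Finset.sum_add_distrib]
      map_smul' := fun c x => by
        simp only [mul_smul_comm, smul_mul_assoc, Finset.smul_sum, RingHom.id_apply] }
  map_add' a a' := by
    ext x
    simp only [LinearMap.coe_mk, AddHom.coe_mk, LinearMap.add_apply, Pi.add_apply, add_mul,
      Finset.sum_add_distrib]
  map_smul' c a := by
    ext x
    simp only [LinearMap.coe_mk, AddHom.coe_mk, LinearMap.smul_apply, Pi.smul_apply,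
      smul_mul_assoc, Finset.smul_sum, RingHom.id_apply]

theorem sumMulMul_apply {I : Type*} [Fintype I] (b : I → A) (a : I → A) (x : A) :
    sumMulMul (F := F) b a x = ∑ i, a i * x * b i := rfl

/-- This is A ⊗ Aᵒᵖ ≅ End(A) in coordinates: the coefficient map is injective, and both sides have
dimension (dim A)². -/
theorem exists_forall_eq_sum_mul_mul [Algebra.IsCentral F A] [IsSimpleRing A]
    [FiniteDimensional F A] {I : Type*} [Fintype I] (b : Module.Basis I F A) (f : A →ₗ[F] A) :
    ∃ a : I → A, ∀ x, f x = ∑ i, a i * x * b i := by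
  have hinj : Function.Injective (sumMulMul (F := F) b) := by
    rw [injective_iff_map_eq_zero]
    intro a ha
    funext i
    exact eq_zero_of_forall_sum_mul_mul_eq_zero b.linearIndependent Finset.univ a
      (fun x => by rw [← sumMulMul_apply (F := F), ha]; rfl) i (Finset.mem_univ i)
  have hfin : Module.finrank F (I → A) = Module.finrank F (Module.End F A) := by
    rw [Module.finrank_pi_fintype, Module.finrank_linearMap, Finset.sum_const, Finset.card_univ,
      ← Module.finrank_eq_card_basis b, smul_eq_mul]
  obtain ⟨a, ha⟩ := (LinearMap.injective_iff_surjective_of_finrank_eq_finrank hfin).1 hinj f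
  exact ⟨a, fun x => by rw [← ha, sumMulMul_apply]⟩

/-- If `x ↦ ∑ aᵢ x bᵢ` intertwines left multiplications by `p` and `r`, then so does each `aᵢ`. -/
theorem mul_eq_mul_of_intertwines [Algebra.IsCentral F A] [IsSimpleRing A]
    {I : Type*} [Fintype I] (b : Module.Basis I F A) {f : A → A} {a : I → A}
    (hf : ∀ x, f x = ∑ i, a i * x * b i) {p r : A} (h : ∀ x, f (p * x) = r * f x) (i : I) :
    a i * p = r * a i := by
  refine sub_eq_zero.1 (eq_zero_of_forall_sum_mul_mul_eq_zero b.linearIndependent Finset.univ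
    (fun i => a i * p - r * a i) (fun x => ?_) i (Finset.mem_univ i))
  have := h x
  simp only [hf, Finset.mul_sum] at this
  simpa only [sub_mul, Finset.sum_sub_distrib, mul_assoc, sub_eq_zero] using this

/-- View A as a left K-space. A map ∑ aᵢ x bᵢ is K-linear exactly when all aᵢ centralize K, so
C^(dim A) ≅ End_K(A). Comparing F-dimensions gives dim_F C = dim_K A. -/
theorem finrank_centralizer_mul_finrank [Algebra.IsCentral F A] [IsSimpleRing A]
    [FiniteDimensional F A] {K : Type*} [Field K] [Algebra F K] (j : K →ₐ[F] A) :
    Module.finrank F (Subalgebra.centralizer F (Set.range j)) * Module.finrank F K =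
      Module.finrank F A := by
  let : Module K A := Module.compHom A j.toRingHom
  have hsmul : ∀ (z : K) (x : A), z • x = j z * x := fun _ _ => rfl
  have : IsScalarTower F K A := ⟨fun c z x => by
    rw [hsmul, hsmul, map_smul, smul_mul_assoc]⟩
  have : FiniteDimensional K A := Module.Finite.of_restrictScalars_finite F K A
  have : FiniteDimensional F K :=
    FiniteDimensional.of_injective j.toLinearMap j.toRingHom.injective
  let b := Module.finBasis F A
  set C := Subalgebra.centralizer F (Set.range j) with hC
  have hcomm : ∀ (c : C) (z : K), j z * (c : A) = c * j z := fun c z =>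
    Subalgebra.mem_centralizer_iff F |>.1 c.2 _ ⟨z, rfl⟩
  have : SMulCommClass K F A := ⟨fun z c x => by rw [hsmul, hsmul, mul_smul_comm]⟩
  let L : (Fin (Module.finrank F A) → C) →ₗ[F] (A →ₗ[K] A) :=
    { toFun := fun a =>
        { toFun := fun x => ∑ i, (a i : A) * x * b i
          map_add' := fun x y => by simp only [mul_add, add_mul, Finset.sum_add_distrib]
          map_smul' := fun z x => by
            simp only [hsmul, RingHom.id_apply, Finset.mul_sum, ← mul_assoc, hcomm] }
      map_add' := fun a a' => by
        ext x
        simp [add_mul, Finset.sum_add_distrib]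
      map_smul' := fun c a => by
        ext x
        simp [Finset.smul_sum] }
  have hL : ∀ a x, L a x = ∑ i, (a i : A) * x * b i := fun _ _ => rfl
  have hbij : Function.Bijective L := by
    constructor
    · rw [injective_iff_map_eq_zero]
      intro a ha
      funext i
      refine Subtype.ext (eq_zero_of_forall_sum_mul_mul_eq_zero b.linearIndependent Finset.univ
        (fun i => (a i : A)) (fun x => ?_) i (Finset.mem_univ i))
      rw [← hL, ha]
      rfl
    · intro f
      obtain ⟨a, ha⟩ := exists_forall_eq_sum_mul_mul b (f.restrictScalars F)
      have hmem : ∀ i, a i ∈ C := fun i => by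
        rw [hC, Subalgebra.mem_centralizer_iff]
        rintro _ ⟨z, rfl⟩
        exact (mul_eq_mul_of_intertwines b ha (fun x => by
          rw [← hsmul, ← hsmul]; exact f.map_smul z x) i).symm
      refine ⟨fun i => ⟨a i, hmem i⟩, LinearMap.ext fun x => ?_⟩
      rw [hL]
      exact (ha x).symm
  have h₁ := (LinearEquiv.ofBijective L hbij).finrank_eq
  rw [Module.finrank_pi_fintype, Finset.sum_const, Finset.card_univ, Fintype.card_fin,
    smul_eq_mul, ← Module.finrank_mul_finrank F K (A →ₗ[K] A), Module.finrank_linearMap,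
    ← Module.finrank_mul_finrank F K A, mul_assoc] at h₁
  have hK : 0 < Module.finrank F K := Module.finrank_pos
  have hA : 0 < Module.finrank K A := Module.finrank_pos
  have h₂ := Nat.eq_of_mul_eq_mul_left hA (Nat.eq_of_mul_eq_mul_left hK h₁)
  rw [h₂, mul_comm, Module.finrank_mul_finrank]

end CentralSimple

/-! ### Maximal subfields and Skolem–Noether. -/

section MaximalSubfield

variable {F M A : Type*} [Field F] [Field M] [Algebra F M] [Ring A] [Algebra F A]
  [Algebra.IsCentral F A] [IsSimpleRing A] [FiniteDimensional F A]

/-- A subfield of degree `n` in a central simple algebra of degree `n` is its own centralizer. -/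
theorem centralizer_range_eq_range (ι : M →ₐ[F] A)
    (h : Module.finrank F A = Module.finrank F M ^ 2) :
    Subalgebra.centralizer F (Set.range ι) = ι.range := by
  have : FiniteDimensional F M :=
    FiniteDimensional.of_injective ι.toLinearMap ι.toRingHom.injective
  have hpos : 0 < Module.finrank F M := Module.finrank_pos
  have hle : ι.range ≤ Subalgebra.centralizer F (Set.range ι) := by
    rintro _ ⟨m, rfl⟩
    rw [Subalgebra.mem_centralizer_iff]
    rintro _ ⟨m', rfl⟩
    simp only [AlgHom.toRingHom_eq_coe, RingHom.coe_coe, ← map_mul, mul_comm]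
  have hC := finrank_centralizer_mul_finrank ι
  rw [h, sq] at hC
  have hC := Nat.eq_of_mul_eq_mul_right hpos hC
  have hr : Module.finrank F ι.range = Module.finrank F M :=
    (AlgEquiv.ofInjective ι ι.toRingHom.injective).toLinearEquiv.finrank_eq.symm
  exact (Subalgebra.eq_of_le_of_finrank_eq hle (hr.trans hC.symm)).symm

/-- The Skolem–Noether theorem for automorphisms of a maximal subfield. -/
theorem exists_unit_conj_eq (ι : M →ₐ[F] A)
    (h : Module.finrank F A = Module.finrank F M ^ 2) (σ : M ≃ₐ[F] M) :
    ∃ u : Aˣ, ∀ m, u * ι m = ι (σ m) * u := by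
  let : Module M A := Module.compHom A ι.toRingHom
  have hsmul : ∀ (z : M) (x : A), z • x = ι z * x := fun _ _ => rfl
  have : IsScalarTower F M A := ⟨fun c z x => by
    rw [hsmul, hsmul, map_smul, smul_mul_assoc]⟩
  have : FiniteDimensional M A := Module.Finite.of_restrictScalars_finite F M A
  -- Applying `s` to the coordinates in a left M-basis of A gives an `s`-semilinear map, whose
  -- coefficients in the form ∑ aᵢ x bᵢ intertwine the action of `s`.
  have key : ∀ s : M ≃ₐ[F] M, ∃ f : A →ₗ[F] A,
      (∀ x, f x = (Module.finBasis M A).equivFun.symm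
        (fun i => s ((Module.finBasis M A).equivFun x i))) := fun s =>
    ⟨((Module.finBasis M A).equivFun.symm.toLinearMap.restrictScalars F) ∘ₗ
      (LinearMap.pi fun i => s.toLinearMap ∘ₗ LinearMap.proj i) ∘ₗ
      ((Module.finBasis M A).equivFun.toLinearMap.restrictScalars F), fun x => rfl⟩
  have key' : ∀ (s : M ≃ₐ[F] M) (f : A →ₗ[F] A), (∀ x, f x = (Module.finBasis M A).equivFun.symm
        (fun i => s ((Module.finBasis M A).equivFun x i))) →
        ∀ m x, f (ι m * x) = ι (s m) * f x := by
    intro s f hf m x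
    rw [← hsmul, ← hsmul, hf, hf, ← map_smul]
    congr 1
    funext i
    simp
  obtain ⟨f, hf⟩ := key σ
  obtain ⟨g, hg⟩ := key σ.symm
  have hgf : ∀ x, g (f x) = x := fun x => by
    rw [hg, hf, LinearEquiv.apply_symm_apply]
    simp only [AlgEquiv.symm_apply_apply, LinearEquiv.symm_apply_apply]
  let b := Module.finBasis F A
  obtain ⟨a, ha⟩ := exists_forall_eq_sum_mul_mul b f
  obtain ⟨a', ha'⟩ := exists_forall_eq_sum_mul_mul b g
  have hai := fun m i => mul_eq_mul_of_intertwines b ha (key' σ f hf m) i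
  have hai' := fun m i => mul_eq_mul_of_intertwines b ha' (key' σ.symm g hg m) i
  -- As `g ∘ f` is the identity, some product is nonzero. It commutes with M, so it lies in the
  -- field M and is invertible; hence `a j` has a left inverse, which is two-sided in the Artinian
  -- ring A.
  obtain ⟨i, j, hij⟩ : ∃ i j, a' i * a j ≠ 0 := by
    by_contra! hzero
    have h1 := hgf 1
    rw [ha, ha'] at h1
    refine one_ne_zero (α := A) (h1.symm.trans (Finset.sum_eq_zero fun i _ => ?_))
    rw [Finset.mul_sum, Finset.sum_mul]
    refine Finset.sum_eq_zero fun j _ => ?_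
    rw [← mul_assoc, ← mul_assoc, hzero, zero_mul, zero_mul, zero_mul]
  have hmem : a' i * a j ∈ ι.range := by
    rw [← centralizer_range_eq_range ι h, Subalgebra.mem_centralizer_iff]
    rintro _ ⟨m, rfl⟩
    rw [mul_assoc, hai, ← mul_assoc (a' i), hai', AlgEquiv.symm_apply_apply, mul_assoc]
  obtain ⟨m, hm⟩ := hmem
  have hm : ι m = a' i * a j := hm
  have hm0 : m ≠ 0 := by
    rintro rfl
    exact hij (by rw [← hm, map_zero])
  have : IsArtinianRing A := IsArtinianRing.of_finite F A
  have hleft : (ι m⁻¹ * a' i) * a j = 1 := by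
    rw [mul_assoc, ← hm, ← map_mul, inv_mul_cancel₀ hm0, map_one]
  have hright : a j * (ι m⁻¹ * a' i) = 1 := mul_eq_one_symm hleft
  exact ⟨⟨a j, ι m⁻¹ * a' i, hright, hleft⟩, fun m => hai m j⟩

end MaximalSubfield

/-- A version of Dedekind's independence of characters: if `aₜ z = χₜ(z) aₜ` for pairwise distinct
`χₜ`, then a subgroup stable under the multiplications by the `z` on the right and by the field on
the left contains each `aₜ` as soon as it contains their sum. -/
theorem mem_of_sum_mem_of_distinct_characters {M A T Z : Type*} [Field M] [Ring A] (ι : M →+* A)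
    (z : Z → A) (χ : T → Z → M) (J : AddSubgroup A) (hl : ∀ m, ∀ x ∈ J, ι m * x ∈ J)
    (hr : ∀ w, ∀ x ∈ J, x * z w ∈ J) (s : Finset T) (hχ : Set.InjOn χ s) (a : T → A)
    (ha : ∀ t ∈ s, ∀ w, a t * z w = ι (χ t w) * a t) (h : ∑ t ∈ s, a t ∈ J) :
    ∀ t ∈ s, a t ∈ J := by
  classical
  induction s using Finset.induction_on generalizing a with
  | empty => simp
  | insert j s hj ih =>
    have hs : ∀ t ∈ s, a t ∈ J := by
      intro t ht
      obtain ⟨w, hw⟩ : ∃ w, χ t w ≠ χ j w := by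
        by_contra! heq
        exact ne_of_mem_of_not_mem ht hj (hχ (by simp [ht]) (by simp) (funext heq))
      -- Right multiplication by `z w` minus left multiplication by `χ j w` kills the `j`-th term
      -- and scales the `t`-th by a nonzero element of M.
      have key : ∑ t ∈ s, ι (χ t w - χ j w) * a t ∈ J := by
        have := J.sub_mem (hr w _ h) (hl (χ j w) _ h)
        rw [Finset.sum_insert hj, add_mul, mul_add, ha j (Finset.mem_insert_self _ _),
          add_sub_add_left_eq_sub, Finset.sum_mul, Finset.mul_sum, ← Finset.sum_sub_distrib] at this
        convert this using 2 with i hi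
        rw [map_sub, sub_mul, ha i (Finset.mem_insert_of_mem hi)]
      have := ih (hχ.mono (by simp)) (fun t => ι (χ t w - χ j w) * a t) (fun i hi v => by
        rw [mul_assoc, ha i (Finset.mem_insert_of_mem hi), ← mul_assoc, ← mul_assoc, ← map_mul,
          ← map_mul, mul_comm]) key t ht
      have := hl (χ t w - χ j w)⁻¹ _ this
      rwa [← mul_assoc, ← map_mul, inv_mul_cancel₀ (sub_ne_zero.2 hw), map_one, one_mul] at this
    intro t ht
    rcases Finset.mem_insert.1 ht with rfl | ht
    · rw [Finset.sum_insert hj] at h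
      exact (J.add_mem_cancel_right (J.sum_mem hs)).1 h
    · exact hs t ht

/-! ### The centralizers M(H) as crossed products. -/

section Crossed

variable {F M A : Type*} [Field F] [Field M] [Algebra F M] [Ring A] [Algebra F A]

theorem mem_crossedSubalgebra {ι : M →ₐ[F] A} {H : Subgroup (M ≃ₐ[F] M)} {x : A} :
    x ∈ crossedSubalgebra ι H ↔ ∀ z ∈ IntermediateField.fixedField H, ι z * x = x * ι z := by
  rw [crossedSubalgebra, Subalgebra.mem_centralizer_iff]
  simp

theorem mem_crossedSubalgebra_of_mul_eq {ι : M →ₐ[F] A} {H : Subgroup (M ≃ₐ[F] M)} {x : A}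
    {σ : M ≃ₐ[F] M} (hσ : σ ∈ H) (hx : ∀ m, x * ι m = ι (σ m) * x) :
    x ∈ crossedSubalgebra ι H :=
  mem_crossedSubalgebra.2 fun z hz => by
    rw [hx, (IntermediateField.mem_fixedField_iff H z).1 hz σ hσ]

theorem apply_mem_crossedSubalgebra (ι : M →ₐ[F] A) (H : Subgroup (M ≃ₐ[F] M)) (m : M) :
    ι m ∈ crossedSubalgebra ι H :=
  mem_crossedSubalgebra_of_mul_eq H.one_mem fun m' => by
    rw [AlgEquiv.one_apply, ← map_mul, mul_comm, map_mul]

theorem crossedSubalgebra_mono (ι : M →ₐ[F] A) {H H' : Subgroup (M ≃ₐ[F] M)} (h : H ≤ H') :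
    crossedSubalgebra ι H ≤ crossedSubalgebra ι H' := fun _ hx =>
  mem_crossedSubalgebra.2 fun z hz =>
    mem_crossedSubalgebra.1 hx z (IntermediateField.fixedField_le h hz)

theorem centralizer_range_comp_val_fixedField (ι : M →ₐ[F] A) (H : Subgroup (M ≃ₐ[F] M)) :
    Subalgebra.centralizer F (Set.range (ι.comp (IntermediateField.fixedField H).val)) =
      crossedSubalgebra ι H := by
  rw [crossedSubalgebra]
  congr 1
  ext
  simp

variable [Algebra.IsCentral F A] [IsSimpleRing A] [FiniteDimensional F A]

theorem finrank_crossedSubalgebra_mul (ι : M →ₐ[F] A) (H : Subgroup (M ≃ₐ[F] M)) :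
    Module.finrank F (crossedSubalgebra ι H) *
      Module.finrank F (IntermediateField.fixedField H) = Module.finrank F A := by
  rw [← finrank_centralizer_mul_finrank (ι.comp (IntermediateField.fixedField H).val),
    centralizer_range_comp_val_fixedField]

/-- Divide (dim M)² by [Fix(H) : F], using Artin's [M : Fix(H)] = |H|. -/
theorem finrank_crossedSubalgebra [FiniteDimensional F M] (ι : M →ₐ[F] A)
    (h : Module.finrank F A = Module.finrank F M ^ 2) (H : Subgroup (M ≃ₐ[F] M)) :
    Module.finrank F (crossedSubalgebra ι H) = Nat.card H * Module.finrank F M := by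
  have h₁ := finrank_crossedSubalgebra_mul ι H
  have h₂ := Module.finrank_mul_finrank F (IntermediateField.fixedField H) M
  rw [IntermediateField.finrank_fixedField_eq_card] at h₂
  have hpos : 0 < Module.finrank F (IntermediateField.fixedField H) := Module.finrank_pos
  refine Nat.eq_of_mul_eq_mul_right hpos ?_
  rw [h₁, h]
  nth_rw 2 [← h₂]
  rw [sq, ← h₂]
  ring

/-- The centralizer of `Fix(H)` is spanned over `M` by units inducing the elements of `H`. -/
theorem exists_eq_sum_of_mem_crossedSubalgebra [FiniteDimensional F M] (ι : M →ₐ[F] A)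
    (h : Module.finrank F A = Module.finrank F M ^ 2) (H : Subgroup (M ≃ₐ[F] M)) [Fintype H]
    (u : (M ≃ₐ[F] M) → Aˣ) (hu : ∀ σ m, u σ * ι m = ι (σ m) * u σ) {x : A}
    (hx : x ∈ crossedSubalgebra ι H) : ∃ a : H → M, x = ∑ σ, ι (a σ) * u σ := by
  have hmem : ∀ a : H → M, ∑ σ, ι (a σ) * (u σ : A) ∈ crossedSubalgebra ι H := fun a =>
    Subalgebra.sum_mem _ fun σ _ => Subalgebra.mul_mem _ (apply_mem_crossedSubalgebra ι H _)
      (mem_crossedSubalgebra_of_mul_eq σ.2 (hu σ))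
  let Ψ : (H → M) →ₗ[F] crossedSubalgebra ι H :=
    { toFun := fun a => ⟨∑ σ, ι (a σ) * (u σ : A), hmem a⟩
      map_add' := fun a b => Subtype.ext (by simp [add_mul, Finset.sum_add_distrib])
      map_smul' := fun c a => Subtype.ext (by simp [Finset.smul_sum]) }
  have hΨ : ∀ a, (Ψ a : A) = ∑ σ, ι (a σ) * (u σ : A) := fun _ => rfl
  have hinj : Function.Injective Ψ := by
    rw [injective_iff_map_eq_zero]
    intro a ha
    funext σ
    have h0 : ∑ σ, ι (a σ) * (u σ : A) ∈ (⊥ : AddSubgroup A) := by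
      rw [← hΨ, ha]
      simp
    have := mem_of_sum_mem_of_distinct_characters (ι : M →+* A) (fun m : M => ι m)
      (fun (σ : H) m => (σ : M ≃ₐ[F] M) m) ⊥ (by simp) (by simp) Finset.univ
      (fun σ _ τ _ e => Subtype.ext (AlgEquiv.ext fun m => congrFun e m))
      (fun σ => ι (a σ) * (u σ : A)) (fun σ _ m => by
        rw [mul_assoc, hu, ← mul_assoc, ← mul_assoc, ← map_mul, mul_comm, map_mul]
        rfl) h0 σ (Finset.mem_univ σ)
    rw [AddSubgroup.mem_bot, Units.mul_left_eq_zero] at this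
    exact (map_eq_zero ι).1 this
  have hfin : Module.finrank F (H → M) = Module.finrank F (crossedSubalgebra ι H) := by
    rw [finrank_crossedSubalgebra ι h, Module.finrank_pi_fintype, Finset.sum_const,
      Finset.card_univ, smul_eq_mul, Nat.card_eq_fintype_card]
  obtain ⟨a, ha⟩ := (LinearMap.injective_iff_surjective_of_finrank_eq_finrank hfin).1 hinj ⟨x, hx⟩
  exact ⟨a, by rw [← hΨ, ha]⟩

/-- A nonzero ideal of the centralizer of `Fix(H)` contains `1`. -/
theorem isSimpleRing_crossedSubalgebra [FiniteDimensional F M] (ι : M →ₐ[F] A)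
    (h : Module.finrank F A = Module.finrank F M ^ 2) (H : Subgroup (M ≃ₐ[F] M)) :
    IsSimpleRing (crossedSubalgebra ι H) := by
  have : Fintype H := Fintype.ofFinite H
  choose u hu using exists_unit_conj_eq ι h
  refine ⟨⟨fun J => ?_⟩⟩
  refine or_iff_not_imp_left.2 fun hJ => ?_
  obtain ⟨x, hxJ, hx0⟩ : ∃ x ∈ J, x ≠ 0 := by
    by_contra! hall
    exact hJ (le_antisymm (fun y hy => (TwoSidedIdeal.mem_bot _).2 (hall y hy)) bot_le)
  obtain ⟨a, ha⟩ := exists_eq_sum_of_mem_crossedSubalgebra ι h H u hu x.2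
  -- Seen inside A, the ideal is stable under M on both sides, so Dedekind's argument puts every
  -- term `ι (a σ) * u σ` of `x` in it. A nonzero term is a unit of M(H).
  let J' : AddSubgroup A :=
    { carrier := {y | ∃ hy : y ∈ crossedSubalgebra ι H, (⟨y, hy⟩ : crossedSubalgebra ι H) ∈ J}
      zero_mem' := ⟨Subalgebra.zero_mem _, J.zero_mem⟩
      add_mem' := fun ⟨h₁, h₂⟩ ⟨h₃, h₄⟩ => ⟨Subalgebra.add_mem _ h₁ h₃, J.add_mem h₂ h₄⟩
      neg_mem' := fun ⟨h₁, h₂⟩ => ⟨Subalgebra.neg_mem _ h₁, J.neg_mem h₂⟩ }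
  have hJ' : ∀ y, y ∈ J' ↔
      ∃ hy : y ∈ crossedSubalgebra ι H, (⟨y, hy⟩ : crossedSubalgebra ι H) ∈ J := fun _ => Iff.rfl
  have hι := apply_mem_crossedSubalgebra ι H
  have hall := mem_of_sum_mem_of_distinct_characters (ι : M →+* A) (fun m : M => ι m)
    (fun (σ : H) m => (σ : M ≃ₐ[F] M) m) J'
    (fun m y ⟨h₁, h₂⟩ => ⟨Subalgebra.mul_mem _ (hι m) h₁, J.mul_mem_left ⟨_, hι m⟩ _ h₂⟩)
    (fun m y ⟨h₁, h₂⟩ => ⟨Subalgebra.mul_mem _ h₁ (hι m), J.mul_mem_right _ ⟨_, hι m⟩ h₂⟩)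
    Finset.univ (fun σ _ τ _ e => Subtype.ext (AlgEquiv.ext fun m => congrFun e m))
    (fun σ => ι (a σ) * (u σ : A)) (fun σ _ m => by
      rw [mul_assoc, hu, ← mul_assoc, ← mul_assoc, ← map_mul, mul_comm, map_mul]
      rfl) ((hJ' _).2 (by rw [← ha]; exact ⟨x.2, hxJ⟩))
  obtain ⟨σ, hσ⟩ : ∃ σ, a σ ≠ 0 := by
    by_contra! hzero
    refine hx0 (Subtype.ext ?_)
    rw [ha]
    simp [hzero]
  obtain ⟨hy, hyJ⟩ := (hJ' _).1 (hall σ (Finset.mem_univ σ))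
  have huinv : ((u σ)⁻¹ : Aˣ) * ι (a σ)⁻¹ ∈ crossedSubalgebra ι H := by
    refine Subalgebra.mul_mem _ (mem_crossedSubalgebra_of_mul_eq (H.inv_mem σ.2) fun m => ?_) (hι _)
    rw [Units.inv_mul_eq_iff_eq_mul, ← mul_assoc, hu, mul_assoc, Units.mul_inv, mul_one]
    exact congrArg ι (AlgEquiv.apply_symm_apply σ.1 m).symm
  have h1 : (⟨_, hy⟩ * ⟨_, huinv⟩ : crossedSubalgebra ι H) = 1 := Subtype.ext (by
    change ι (a σ) * (u σ : A) * (((u σ)⁻¹ : Aˣ) * ι (a σ)⁻¹) = 1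
    rw [mul_assoc, Units.mul_inv_cancel_left, ← map_mul, mul_inv_cancel₀ hσ, map_one])
  refine TwoSidedIdeal.one_mem_iff J |>.1 ?_
  rw [← h1]
  exact J.mul_mem_right _ _ hyJ

theorem crossedSubalgebra_bot (ι : M →ₐ[F] A)
    (h : Module.finrank F A = Module.finrank F M ^ 2) : crossedSubalgebra ι ⊥ = ι.range := by
  rw [← centralizer_range_eq_range ι h, crossedSubalgebra, IntermediateField.fixedField_bot]
  congr 1
  ext
  simp

/-- The centralizer of `Fix(H)` is an `H`-crossed product algebra over `Fix(H)`. -/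
theorem isCrossedProductOverFix_crossedSubalgebra [FiniteDimensional F M] (ι : M →ₐ[F] A)
    (h : Module.finrank F A = Module.finrank F M ^ 2) (H : Subgroup (M ≃ₐ[F] M)) :
    IsCrossedProductOverFix ι H (crossedSubalgebra ι H) := by
  have hZ : ∀ z ∈ IntermediateField.fixedField H, ∀ b ∈ crossedSubalgebra ι H, ι z * b = b * ι z :=
    fun z hz b hb => mem_crossedSubalgebra.1 hb z hz
  refine ⟨apply_mem_crossedSubalgebra ι H, hZ, ?_⟩
  let _ : Algebra (IntermediateField.fixedField H) (crossedSubalgebra ι H) :=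
    algebraOverFix ι H _ (apply_mem_crossedSubalgebra ι H) hZ
  have hcard : Module.finrank (IntermediateField.fixedField H) M = Nat.card H :=
    IntermediateField.finrank_fixedField_eq_card H
  have halg : ∀ z : IntermediateField.fixedField H,
      (algebraMap (IntermediateField.fixedField H) (crossedSubalgebra ι H) z : A) = ι z :=
    fun _ => rfl
  have : IsScalarTower F (IntermediateField.fixedField H) (crossedSubalgebra ι H) :=
    IsScalarTower.of_algebraMap_eq fun c => Subtype.ext (by
      rw [halg]
      exact (ι.commutes c).symm)
  have hgal : IsGalois (IntermediateField.fixedField H) M := IsGalois.of_fixed_field M H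
  have hfin : FiniteDimensional (IntermediateField.fixedField H) (crossedSubalgebra ι H) :=
    Module.Finite.of_restrictScalars_finite F _ _
  refine ⟨⟨⟨fun x hx => ?_⟩, isSimpleRing_crossedSubalgebra ι h H, hfin, ?_⟩, hgal, ?_⟩
  -- A central element commutes with M, so it lies in M; commuting with the units that induce H, it
  -- is fixed by H.
  · rw [Subalgebra.mem_center_iff] at hx
    have hx' : ∀ y ∈ crossedSubalgebra ι H, y * x = x * y := fun y hy =>
      congrArg Subtype.val (hx ⟨y, hy⟩)
    have hxM : (x : A) ∈ ι.range := by
      rw [← centralizer_range_eq_range ι h, Subalgebra.mem_centralizer_iff]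
      rintro _ ⟨m, rfl⟩
      exact hx' _ (apply_mem_crossedSubalgebra ι H m)
    obtain ⟨m, hm⟩ := hxM
    have hm : ι m = x := hm
    have hmfix : m ∈ IntermediateField.fixedField H := by
      rw [IntermediateField.mem_fixedField_iff]
      intro σ hσ
      obtain ⟨u, hu⟩ := exists_unit_conj_eq ι h σ
      have := hx' u (mem_crossedSubalgebra_of_mul_eq hσ hu)
      rw [← hm, hu] at this
      exact ι.toRingHom.injective ((Units.mul_left_inj u).1 this)
    exact Algebra.mem_bot.2 ⟨⟨m, hmfix⟩, Subtype.ext hm⟩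
  · have h₁ := Module.finrank_mul_finrank F (IntermediateField.fixedField H)
      (crossedSubalgebra ι H)
    have h₂ := Module.finrank_mul_finrank F (IntermediateField.fixedField H) M
    rw [finrank_crossedSubalgebra ι h, ← h₂, hcard] at h₁
    rw [hcard]
    have hpos : 0 < Module.finrank F (IntermediateField.fixedField H) := Module.finrank_pos
    refine Nat.eq_of_mul_eq_mul_left hpos ?_
    rw [h₁]
    ring
  · exact
      { faithful := inferInstance
        commutes := ⟨fun σ z m => by
          rw [Algebra.smul_def, Algebra.smul_def, smul_mul']
          congr 1
          exact (IntermediateField.mem_fixedField_iff H z.1).1 z.2 σ.1 σ.2⟩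
        isInvariant := ⟨fun m hm =>
          ⟨⟨m, (IntermediateField.mem_fixedField_iff H m).2 fun σ hσ => hm ⟨σ, hσ⟩⟩, rfl⟩⟩ }

end Crossed

/-! ### Quotients of skew polynomial rings. -/

section CyclicExtension

variable {F B B' : Type*} [Field F] [Ring B] [Algebra F B] [Ring B'] [Algebra F B']

theorem twist_smul (τ : B ≃ₐ[F] B) (n : Multiplicative ℕ) (b : B) :
    n • Twist.of τ b = Twist.of τ ((τ ^ n.toAdd) b) := rfl

theorem mul_pow_eq_pow_apply_mul {τ : B ≃ₐ[F] B} {j : B →ₐ[F] B'} {u : B'}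
    (hu : ∀ b, u * j b = j (τ b) * u) (n : ℕ) (b : B) :
    u ^ n * j b = j ((τ ^ n) b) * u ^ n := by
  induction n generalizing b with
  | zero => simp
  | succ n ih => rw [pow_succ, mul_assoc, hu, ← mul_assoc, ih, mul_assoc, pow_succ]; rfl

/-- The homomorphism `B[t; τ] → B'` extending `j : B → B'` and sending `t` to `u`. -/
noncomputable def skewEval (τ : B ≃ₐ[F] B) (j : B →ₐ[F] B') (u : B')
    (hu : ∀ b, u * j b = j (τ b) * u) : SkewPolynomial (Twist τ) →ₐ[F] B' :=
  SkewMonoidAlgebra.liftNCAlgHom (j.comp (Twist.of τ).symm.toAlgHom) (powersHom B' u)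
    (fun {x y} => (mul_pow_eq_pow_apply_mul hu y.toAdd x).symm)

theorem skewEval_monomial (τ : B ≃ₐ[F] B) (j : B →ₐ[F] B') (u : B')
    (hu : ∀ b, u * j b = j (τ b) * u) (n : ℕ) (b : B) :
    skewEval τ j u hu (SkewPolynomial.monomial n (Twist.of τ b)) = j b * u ^ n := by
  change SkewMonoidAlgebra.liftNC _ _ (SkewMonoidAlgebra.single _ _) = _
  rw [SkewMonoidAlgebra.liftNC_single]
  rfl

/-- The difference is the left multiple b tⁿ (t^q - c), since tⁿ c = τⁿ(c) tⁿ. It lowers degrees by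
`q` without two-sidedness. -/
theorem monomial_sub_mem_cyclicIdeal (τ : B ≃ₐ[F] B) (q n : ℕ) (c b : B) :
    SkewPolynomial.monomial (n + q) (Twist.of τ b) -
      SkewPolynomial.monomial n (Twist.of τ (b * (τ ^ n) c)) ∈ cyclicIdeal τ q c := by
  have := Ideal.mul_mem_left (cyclicIdeal τ q c) (SkewPolynomial.monomial n (Twist.of τ b))
    (Ideal.subset_span (Set.mem_singleton _))
  rw [mul_sub, SkewPolynomial.monomial_mul_X_pow, SkewPolynomial.monomial_mul_C,
    SkewPolynomial.φ_iterate_apply, twist_smul, ← map_mul] at this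
  exact this

/-- Division with remainder by `t ^ q - c` in `B[t; τ]`. -/
theorem exists_sub_sum_monomial_mem_cyclicIdeal (τ : B ≃ₐ[F] B) {q : ℕ} (hq : 0 < q) (c : B)
    (p : SkewPolynomial (Twist τ)) :
    ∃ b : Fin q → B,
      p - ∑ k : Fin q, SkewPolynomial.monomial k.1 (Twist.of τ (b k)) ∈ cyclicIdeal τ q c := by
  have hmon : ∀ (n : ℕ) (r : B), ∃ b : Fin q → B, SkewPolynomial.monomial n (Twist.of τ r) -
      ∑ k : Fin q, SkewPolynomial.monomial k.1 (Twist.of τ (b k)) ∈ cyclicIdeal τ q c := by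
    intro n
    induction n using Nat.strong_induction_on with
    | _ n ih =>
      intro r
      rcases lt_or_ge n q with hn | hn
      · refine ⟨Pi.single ⟨n, hn⟩ r, ?_⟩
        rw [Finset.sum_eq_single ⟨n, hn⟩ (fun k _ hk => by
          rw [Pi.single_eq_of_ne hk, map_zero, map_zero]) (by simp), Pi.single_eq_same, sub_self]
        exact Ideal.zero_mem _
      · obtain ⟨b, hb⟩ := ih (n - q) (by omega) (r * (τ ^ (n - q)) c)
        refine ⟨b, ?_⟩
        have := Ideal.add_mem _ (monomial_sub_mem_cyclicIdeal τ q (n - q) c r) hb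
        rwa [Nat.sub_add_cancel hn, sub_add_sub_cancel] at this
  induction p using SkewPolynomial.induction with
  | h0 =>
    refine ⟨0, ?_⟩
    simp
  | ha n r p _ _ ih =>
    obtain ⟨b, hb⟩ := ih
    obtain ⟨b', hb'⟩ := hmon n ((Twist.of τ).symm r)
    refine ⟨b' + b, ?_⟩
    have := Ideal.add_mem _ hb' hb
    rw [AlgEquiv.apply_symm_apply, sub_add_sub_comm, ← Finset.sum_add_distrib] at this
    simpa only [Pi.add_apply, map_add] using this

/-- If `u` induces `τ` on `B`, the power `u ^ q` is `c ∈ B`, and every element of `B'` can be written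
uniquely as `∑ bₖ uᵏ` with `k < q`, then `B'` is the quotient of `B[t; τ]` by `t ^ q - c`. -/
theorem isCyclicExtension_of_unique_sum (τ : B ≃ₐ[F] B) (j : B →ₐ[F] B') (u : B')
    (hu : ∀ b, u * j b = j (τ b) * u) {q : ℕ} (hq : 0 < q) {c : B} (hc : u ^ q = j c)
    (hind : ∀ b : Fin q → B, ∑ k, j (b k) * u ^ k.1 = 0 → ∀ k, b k = 0)
    (hspan : ∀ x, ∃ b : Fin q → B, x = ∑ k, j (b k) * u ^ k.1) :
    IsCyclicExtension τ B' q c := by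
  have hgen : skewEval τ j u hu (SkewPolynomial.X ^ q - SkewPolynomial.C (Twist.of τ c)) = 0 := by
    have h₁ := skewEval_monomial τ j u hu q 1
    have h₂ := skewEval_monomial τ j u hu 0 c
    rw [map_one, SkewPolynomial.monomial_one_right_eq_X_pow] at h₁
    rw [SkewPolynomial.monomial_zero_left] at h₂
    rw [map_sub, h₁, h₂, map_one, one_mul, pow_zero, mul_one, hc, sub_self]
  have hle : cyclicIdeal τ q c ≤ RingHom.ker (skewEval τ j u hu) :=
    (Ideal.span_singleton_le_iff_mem _).2 hgen
  have hsum : ∀ b : Fin q → B, skewEval τ j u hu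
      (∑ k : Fin q, SkewPolynomial.monomial k.1 (Twist.of τ (b k))) = ∑ k, j (b k) * u ^ k.1 :=
    fun b => by
      rw [map_sum]
      exact Finset.sum_congr rfl fun k _ => skewEval_monomial τ j u hu k.1 (b k)
  -- The remainder of a kernel element evaluates to 0, so independence makes it 0. Two-sidedness of
  -- the left ideal then comes free, as it is a kernel.
  have hker : cyclicIdeal τ q c = RingHom.ker (skewEval τ j u hu) := by
    refine le_antisymm hle fun p hp => ?_
    obtain ⟨b, hb⟩ := exists_sub_sum_monomial_mem_cyclicIdeal τ hq c p
    have hzero := hle hb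
    rw [RingHom.mem_ker, map_sub, (RingHom.mem_ker).1 hp, hsum, zero_sub, neg_eq_zero] at hzero
    have hb0 := hind b hzero
    simpa only [hb0, map_zero, Finset.sum_const_zero, sub_zero] using hb
  have hsurj : Function.Surjective (skewEval τ j u hu) := fun x => by
    obtain ⟨b, hb⟩ := hspan x
    exact ⟨_, (hsum b).trans hb.symm⟩
  have htwo : (cyclicIdeal τ q c).IsTwoSided := hker ▸ inferInstance
  exact ⟨htwo, ⟨((Ideal.quotientEquivAlgOfEq F hker).trans
    (Ideal.quotientKerAlgEquivOfSurjective hsurj)).symm⟩⟩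

end CyclicExtension

/-! ### Subgroup chains with factors of prime order. -/

section PrimeIndex

variable {G : Type*} [Group G]

/-- A maximal subgroup above the proper commutator subgroup is normal, and its quotient is simple
and solvable, hence of prime order. -/
theorem exists_normal_prime_index [Finite G] [Nontrivial G] [Group.IsSolvable G] :
    ∃ N : Subgroup G, N.Normal ∧ N.index.Prime := by
  obtain ⟨N, hN, hle⟩ := (eq_top_or_exists_le_coatom (commutator G)).resolve_left
    (Group.IsSolvable.commutator_lt_top_of_nontrivial G).ne
  have hnormal : N.Normal := by
    rw [← Subgroup.commutator_top_left_le_iff]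
    exact (Subgroup.commutator_mono le_rfl le_top).trans hle
  have : Nontrivial (G ⧸ N) := QuotientGroup.nontrivial_iff.2 hN.1
  have : IsSimpleGroup (G ⧸ N) := ⟨fun K _ => by
    rcases hN.le_iff.1 (QuotientGroup.le_comap_mk' N K) with h | h
    · refine Or.inr (Subgroup.comap_injective (QuotientGroup.mk'_surjective N) ?_)
      rw [h, Subgroup.comap_top]
    · refine Or.inl (Subgroup.comap_injective (QuotientGroup.mk'_surjective N) ?_)
      rw [h, MonoidHom.comap_bot, QuotientGroup.ker_mk']⟩
  have hcomm : IsMulCommutative (G ⧸ N) :=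
    ⟨⟨IsSimpleGroup.comm_iff_isSolvable.2 inferInstance⟩⟩
  exact ⟨N, hnormal, Group.is_simple_iff_prime_card.1 inferInstance⟩

/-- The induction runs over subgroups of one fixed group, so that all terms of the chain have the
same ambient type. -/
theorem exists_chain_prime_relIndex [Finite G] [Group.IsSolvable G] (L : Subgroup G) :
    ∃ (k : ℕ) (H : Fin (k + 1) → Subgroup G), H 0 = ⊥ ∧ H (Fin.last k) = L ∧
      ∀ i : Fin k, H i.castSucc < H i.succ ∧ ((H i.castSucc).subgroupOf (H i.succ)).Normal ∧
        ((H i.castSucc).relIndex (H i.succ)).Prime := by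
  induction L using WellFoundedLT.induction with
  | _ L ih =>
    rcases subsingleton_or_nontrivial L with hL | hL
    · refine ⟨0, fun _ => ⊥, rfl, ?_, fun i => i.elim0⟩
      exact L.eq_bot_of_subsingleton.symm
    · obtain ⟨N, hN, hp⟩ := exists_normal_prime_index (G := L)
      have hsub : (N.map L.subtype).subgroupOf L = N := Subgroup.comap_map_eq_self_of_injective
        L.subtype_injective N
      have hlt : N.map L.subtype < L := by
        refine lt_of_le_of_ne (Subgroup.map_subtype_le N) fun h => hp.ne_one ?_
        rw [← hsub, h, Subgroup.subgroupOf_self, Subgroup.index_top]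
      obtain ⟨k, H, h0, hlast, hstep⟩ := ih _ hlt
      refine ⟨k + 1, Fin.snoc H L, ?_, Fin.snoc_last _ _, ?_⟩
      · rw [← Fin.castSucc_zero, Fin.snoc_castSucc (α := fun _ => Subgroup G), h0]
      · intro i
        induction i using Fin.lastCases with
        | last =>
          rw [Fin.succ_last, Fin.snoc_last (α := fun _ => Subgroup G),
            Fin.snoc_castSucc (α := fun _ => Subgroup G), hlast, Subgroup.relIndex, hsub]
          exact ⟨hlt, hN, hp⟩
        | cast i =>
          rw [Fin.succ_castSucc, Fin.snoc_castSucc (α := fun _ => Subgroup G),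
            Fin.snoc_castSucc (α := fun _ => Subgroup G)]
          exact hstep i

theorem exists_primeSeries (G : Type*) [Group G] [Finite G] [Group.IsSolvable G] :
    ∃ k : ℕ, Nonempty (PrimeSeries G k) := by
  obtain ⟨k, H, h0, hlast, hstep⟩ := exists_chain_prime_relIndex (⊤ : Subgroup G)
  exact ⟨k, ⟨
    { H := H
      bot := h0
      top := hlast
      lt_succ := fun i => (hstep i).1
      normal := fun i => (hstep i).2.1
      cyclic := fun i => by
        have := (hstep i).2.1
        have : Fact ((H i.castSucc).relIndex (H i.succ)).Prime := ⟨(hstep i).2.2⟩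
        exact isCyclic_of_prime_card (p := (H i.castSucc).relIndex (H i.succ)) rfl
      prime := fun i => (hstep i).2.2 }⟩⟩

namespace PrimeSeries

variable {k : ℕ} (S : PrimeSeries G k) (i : Fin k) {s : S.H i.succ}

theorem q_pos : 0 < S.q i := (S.prime i).pos

theorem orderOf_mk_eq_q (hs : S.Generates i s) :
    orderOf (QuotientGroup.mk s : S.Factor i) = S.q i :=
  orderOf_eq_card_of_zpowers_eq_top hs

theorem pow_mem_iff (hs : S.Generates i s) (m : ℕ) :
    (s : G) ^ m ∈ S.H i.castSucc ↔ S.q i ∣ m := by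
  rw [← S.orderOf_mk_eq_q i hs, orderOf_dvd_iff_pow_eq_one, ← QuotientGroup.mk_pow,
    QuotientGroup.eq_one_iff, Subgroup.mem_subgroupOf, Subgroup.coe_pow]

theorem exists_eq_mul_pow (hs : S.Generates i s) {g : G} (hg : g ∈ S.H i.succ) :
    ∃ h ∈ S.H i.castSucc, ∃ k < S.q i, g = h * s ^ k := by
  have : Finite (S.Factor i) := Nat.finite_of_card_ne_zero (S.prime i).ne_zero
  have hmem : (QuotientGroup.mk ⟨g, hg⟩ : S.Factor i) ∈
      Subgroup.zpowers (QuotientGroup.mk s : S.Factor i) := by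
    rw [show Subgroup.zpowers (QuotientGroup.mk s : S.Factor i) = ⊤ from hs]
    trivial
  classical
  rw [mem_zpowers_iff_mem_range_orderOf, S.orderOf_mk_eq_q i hs, Finset.mem_image] at hmem
  obtain ⟨k, hk, he⟩ := hmem
  refine ⟨g * ((s : G) ^ k)⁻¹, ?_, k, Finset.mem_range.1 hk, (inv_mul_cancel_right _ _).symm⟩
  have h1 : (QuotientGroup.mk (⟨g, hg⟩ * (s ^ k)⁻¹) : S.Factor i) = 1 := by
    rw [QuotientGroup.mk_mul, QuotientGroup.mk_inv, QuotientGroup.mk_pow, ← he, mul_inv_cancel]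
  exact Subgroup.mem_subgroupOf.1 ((QuotientGroup.eq_one_iff _).1 h1)

theorem conj_mem (s : S.H i.succ) {h : G} (hh : h ∈ S.H i.castSucc) :
    (s : G) * h * (s : G)⁻¹ ∈ S.H i.castSucc :=
  Subgroup.mem_subgroupOf.1 ((S.normal i).conj_mem ⟨h, (S.lt_succ i).le hh⟩
    (Subgroup.mem_subgroupOf.2 hh) s)

end PrimeSeries

end PrimeIndex

/-! ### One step of the tower. -/

section Step

variable {F M A : Type*} [Field F] [Field M] [Algebra F M] [Ring A] [Algebra F A]

theorem apply_mem_fixedField_of_conj_mem {H : Subgroup (M ≃ₐ[F] M)} {s : M ≃ₐ[F] M}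
    (hs : ∀ h ∈ H, s⁻¹ * h * s ∈ H) {z : M} (hz : z ∈ IntermediateField.fixedField H) :
    s z ∈ IntermediateField.fixedField H := by
  rw [IntermediateField.mem_fixedField_iff] at hz ⊢
  intro h hh
  have := congrArg s (hz _ (hs h hh))
  rwa [← AlgEquiv.mul_apply, mul_assoc, mul_inv_cancel_left] at this

/-- Since `s` normalizes H, `s⁻¹` maps Fix(H) into itself, so conjugation by `u` respects its
centralizer. -/
theorem units_conj_mem_crossedSubalgebra {ι : M →ₐ[F] A} {H : Subgroup (M ≃ₐ[F] M)}
    {s : M ≃ₐ[F] M} (hs : ∀ h ∈ H, s * h * s⁻¹ ∈ H) {u : Aˣ} (hu : ∀ m, u * ι m = ι (s m) * u)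
    {x : A} (hx : x ∈ crossedSubalgebra ι H) : u * x * (u⁻¹ : Aˣ) ∈ crossedSubalgebra ι H := by
  refine mem_crossedSubalgebra.2 fun z hz => ?_
  have hz' : s⁻¹ z ∈ IntermediateField.fixedField H :=
    apply_mem_fixedField_of_conj_mem (by simpa using hs) hz
  have hsz : s (s⁻¹ z) = z := AlgEquiv.apply_symm_apply s z
  have h₁ : ι z * (u : A) = u * ι (s⁻¹ z) := by rw [hu, hsz]
  have h₂ : ((u⁻¹ : Aˣ) : A) * ι z = ι (s⁻¹ z) * (u⁻¹ : Aˣ) := by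
    rw [Units.inv_mul_eq_iff_eq_mul, ← mul_assoc, ← h₁, Units.mul_inv_cancel_right]
  rw [← mul_assoc, ← mul_assoc, h₁, mul_assoc (u : A) (ι _), mem_crossedSubalgebra.1 hx _ hz',
    mul_assoc, mul_assoc, mul_assoc, ← h₂, mul_assoc]

theorem units_inv_mul_eq {ι : M →ₐ[F] A} {s : M ≃ₐ[F] M} {u : Aˣ}
    (hu : ∀ m, u * ι m = ι (s m) * u) (m : M) :
    ((u⁻¹ : Aˣ) : A) * ι m = ι (s⁻¹ m) * (u⁻¹ : Aˣ) := by
  rw [Units.inv_mul_eq_iff_eq_mul, ← mul_assoc, hu, mul_assoc, Units.mul_inv, mul_one]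
  exact congrArg ι (AlgEquiv.apply_symm_apply s m).symm

theorem units_pow_mul_eq {ι : M →ₐ[F] A} {s : M ≃ₐ[F] M} {u : Aˣ}
    (hu : ∀ m, u * ι m = ι (s m) * u) (k : ℕ) (m : M) :
    ((u ^ k : Aˣ) : A) * ι m = ι ((s ^ k) m) * (u ^ k : Aˣ) := by
  induction k generalizing m with
  | zero => simp
  | succ k ih =>
    rw [pow_succ, Units.val_mul, mul_assoc, hu, ← mul_assoc, ih, mul_assoc, pow_succ]
    rfl

/-- Conjugation by a unit `u` that induces on `M` an automorphism normalizing `H`. -/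
def crossedConj (ι : M →ₐ[F] A) (H : Subgroup (M ≃ₐ[F] M)) (s : M ≃ₐ[F] M)
    (hs : ∀ h ∈ H, s * h * s⁻¹ ∈ H) (hs' : ∀ h ∈ H, s⁻¹ * h * s⁻¹⁻¹ ∈ H) (u : Aˣ)
    (hu : ∀ m, u * ι m = ι (s m) * u) : crossedSubalgebra ι H ≃ₐ[F] crossedSubalgebra ι H where
  toFun x := ⟨u * x * (u⁻¹ : Aˣ), units_conj_mem_crossedSubalgebra hs hu x.2⟩
  invFun x := ⟨(u⁻¹ : Aˣ) * x * (u⁻¹⁻¹ : Aˣ),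
    units_conj_mem_crossedSubalgebra hs' (units_inv_mul_eq hu) x.2⟩
  left_inv x := Subtype.ext (by simp [mul_assoc])
  right_inv x := Subtype.ext (by simp [mul_assoc])
  map_mul' x y := Subtype.ext (by simp [mul_assoc])
  map_add' x y := Subtype.ext (by simp [mul_add, add_mul])
  commutes' r := Subtype.ext (by
    change (u : A) * algebraMap F A r * (u⁻¹ : Aˣ) = algebraMap F A r
    rw [← Algebra.commutes, mul_assoc, Units.mul_inv, mul_one])

section

variable {ι : M →ₐ[F] A} {H : Subgroup (M ≃ₐ[F] M)} {s : M ≃ₐ[F] M}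
  (hs : ∀ h ∈ H, s * h * s⁻¹ ∈ H) (hs' : ∀ h ∈ H, s⁻¹ * h * s⁻¹⁻¹ ∈ H) {u : Aˣ}
  (hu : ∀ m, u * ι m = ι (s m) * u)

theorem coe_crossedConj (x : crossedSubalgebra ι H) :
    (crossedConj ι H s hs hs' u hu x : A) = u * x * (u⁻¹ : Aˣ) := rfl

theorem coe_crossedConj_pow (k : ℕ) (x : crossedSubalgebra ι H) :
    ((crossedConj ι H s hs hs' u hu ^ k) x : A) = (u ^ k : Aˣ) * x * ((u ^ k)⁻¹ : Aˣ) := by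
  induction k generalizing x with
  | zero => simp
  | succ k ih =>
    rw [pow_succ, AlgEquiv.mul_apply, ih, coe_crossedConj, pow_succ, mul_inv_rev, Units.val_mul,
      Units.val_mul]
    simp only [mul_assoc]

theorem coe_crossedConj_of_eq {m : M} {b : crossedSubalgebra ι H} (hb : (b : A) = ι m) :
    (crossedConj ι H s hs hs' u hu b : A) = ι (s m) := by
  rw [coe_crossedConj, hb, hu, Units.mul_inv_cancel_right]

/-- If `s ^ q` is the first power of `s` in `H`, conjugation by `u` has inner order `q`. -/
theorem hasInnerOrder_crossedConj [Nontrivial A] [FiniteDimensional F M] {q : ℕ} (hq : 0 < q)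
    (hpow : ∀ m : ℕ, s ^ m ∈ H ↔ q ∣ m) (c : (crossedSubalgebra ι H)ˣ)
    (hc : ((c : crossedSubalgebra ι H) : A) = (u ^ q : Aˣ)) :
    HasInnerOrder (crossedConj ι H s hs hs' u hu) q := by
  refine ⟨⟨hq, c, fun x => Subtype.ext ?_⟩, ?_⟩
  · rw [coe_crossedConj_pow, Units.mul_inv_eq_iff_eq_mul, Subalgebra.coe_mul, Subalgebra.coe_mul,
      mul_assoc, ← hc, ← Subalgebra.coe_mul _ _ (c : crossedSubalgebra ι H), Units.inv_mul]
    simp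
  -- The unit `w` of M(H) commutes with Fix(H), while `τ ^ m` acts there as `s ^ m`. So `s ^ m`
  -- fixes Fix(H), and the Galois correspondence puts it in H.
  · rintro m ⟨hm, w, hw⟩
    refine Nat.le_of_dvd hm ((hpow m).1 ?_)
    rw [← IntermediateField.fixingSubgroup_fixedField H, IntermediateField.mem_fixingSubgroup_iff]
    intro z hz
    have h₁ := coe_crossedConj_pow hs hs' hu m ⟨ι z, apply_mem_crossedSubalgebra ι H z⟩
    rw [units_pow_mul_eq hu, Units.mul_inv_cancel_right, hw] at h₁
    have h₂ : (w : crossedSubalgebra ι H) * ⟨ι z, apply_mem_crossedSubalgebra ι H z⟩ *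
        (w⁻¹ : (crossedSubalgebra ι H)ˣ) = ⟨ι z, apply_mem_crossedSubalgebra ι H z⟩ := by
      rw [Units.mul_inv_eq_iff_eq_mul]
      exact Subtype.ext (mem_crossedSubalgebra.1 (w : crossedSubalgebra ι H).2 z hz).symm
    rw [h₂] at h₁
    exact (ι.toRingHom.injective h₁).symm

end

variable [Algebra.IsCentral F A] [IsSimpleRing A] [FiniteDimensional F A] [FiniteDimensional F M]

/-- One step of the chain: the centralizer of `Fix(H')` is a cyclic extension of the centralizer
of `Fix(H)` if `H' / H` is cyclic. -/
theorem exists_isCyclicExtension_crossedSubalgebra (ι : M →ₐ[F] A)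
    (h : Module.finrank F A = Module.finrank F M ^ 2) {H H' : Subgroup (M ≃ₐ[F] M)} (hle : H ≤ H')
    {s : M ≃ₐ[F] M} (hsH' : s ∈ H') {q : ℕ} (hq : 0 < q)
    (hs : ∀ h ∈ H, s * h * s⁻¹ ∈ H) (hs' : ∀ h ∈ H, s⁻¹ * h * s⁻¹⁻¹ ∈ H)
    (hpow : ∀ m : ℕ, s ^ m ∈ H ↔ q ∣ m)
    (hrep : ∀ g ∈ H', ∃ h ∈ H, ∃ k < q, g = h * s ^ k) :
    ∃ (τ : crossedSubalgebra ι H ≃ₐ[F] crossedSubalgebra ι H) (c : (crossedSubalgebra ι H)ˣ),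
      HasInnerOrder τ q ∧
      (∀ (m : M) (b : crossedSubalgebra ι H), (b : A) = ι m → (τ b : A) = ι (s m)) ∧
      τ (c : crossedSubalgebra ι H) = c ∧
      IsCyclicExtension τ (crossedSubalgebra ι H') q (c : crossedSubalgebra ι H) := by
  have : Fintype H' := Fintype.ofFinite H'
  choose v hv using exists_unit_conj_eq ι h
  obtain ⟨u, hu⟩ := exists_unit_conj_eq ι h s
  have hsq : s ^ q ∈ H := (hpow q).2 dvd_rfl
  let c : (crossedSubalgebra ι H)ˣ :=
    { val := ⟨(u ^ q : Aˣ), mem_crossedSubalgebra_of_mul_eq hsq (units_pow_mul_eq hu q)⟩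
      inv := ⟨((u ^ q)⁻¹ : Aˣ), mem_crossedSubalgebra_of_mul_eq (H.inv_mem hsq)
        (units_inv_mul_eq (units_pow_mul_eq hu q))⟩
      val_inv := Subtype.ext (u ^ q).mul_inv
      inv_val := Subtype.ext (u ^ q).inv_mul }
  have hc : ((c : crossedSubalgebra ι H) : A) = (u ^ q : Aˣ) := rfl
  have huH' : (u : A) ∈ crossedSubalgebra ι H' := mem_crossedSubalgebra_of_mul_eq hsH' hu
  have hfix : ∀ (k : ℕ) {z : M}, z ∈ IntermediateField.fixedField H →
      (s ^ k) z ∈ IntermediateField.fixedField H := by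
    intro k z hz
    induction k with
    | zero => simpa using hz
    | succ k ih =>
      rw [pow_succ', AlgEquiv.mul_apply]
      exact apply_mem_fixedField_of_conj_mem (by simpa using hs') ih
  refine ⟨crossedConj ι H s hs hs' u hu, c, hasInnerOrder_crossedConj hs hs' hu hq hpow c hc,
    fun m b hb => coe_crossedConj_of_eq hs hs' hu hb, Subtype.ext ?_, ?_⟩
  · rw [coe_crossedConj, hc, ← Units.val_mul, ← Units.val_mul, ← pow_succ', pow_succ,
      mul_inv_cancel_right]
  refine isCyclicExtension_of_unique_sum _ (Subalgebra.inclusion (crossedSubalgebra_mono ι hle))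
    ⟨u, huH'⟩ (fun b => Subtype.ext ?_) hq (Subtype.ext ?_) (fun b hb k => ?_) (fun x => ?_)
  · change (u : A) * b = u * b * (u⁻¹ : Aˣ) * u
    rw [Units.inv_mul_cancel_right]
  · change (u : A) ^ q = (u ^ q : Aˣ)
    rw [Units.val_pow_eq_pow_val]
  · have hb' : ∑ k, (b k : A) * ((u ^ k.1 : Aˣ) : A) ∈ (⊥ : AddSubgroup A) := by
      rw [AddSubgroup.mem_bot]
      have := congrArg Subtype.val hb
      simpa using this
    -- The characters live on Fix(H), not M, because `b k` commutes only with Fix(H). They are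
    -- distinct since `s ^ (l - k)` is outside H for 0 < l - k < q.
    have := mem_of_sum_mem_of_distinct_characters (ι : M →+* A)
      (fun z : IntermediateField.fixedField H => ι z)
      (fun (k : Fin q) z => (s ^ k.1) z) ⊥ (by simp) (by simp) Finset.univ ?_
      (fun k => (b k : A) * ((u ^ k.1 : Aˣ) : A)) (fun k _ z => by
        rw [mul_assoc, units_pow_mul_eq hu, ← mul_assoc, ← mul_assoc]
        congr 1
        exact (mem_crossedSubalgebra.1 (b k).2 _ (hfix k.1 z.2)).symm) hb' k (Finset.mem_univ k)
    · rw [AddSubgroup.mem_bot, Units.mul_left_eq_zero] at this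
      exact Subtype.ext this
    · have key : ∀ k l : Fin q, k ≤ l →
          (∀ z ∈ IntermediateField.fixedField H, (s ^ k.1) z = (s ^ l.1) z) → k = l := by
        intro k l hkl hz
        have hmem : s ^ (l.1 - k.1) ∈ H := by
          rw [← IntermediateField.fixingSubgroup_fixedField H,
            IntermediateField.mem_fixingSubgroup_iff]
          intro z hzH
          apply (s ^ k.1).injective
          rw [← AlgEquiv.mul_apply, ← pow_add, Nat.add_sub_cancel' hkl, hz z hzH]
        have := Nat.eq_zero_of_dvd_of_lt ((hpow _).1 hmem) (by omega)
        exact Fin.ext (by have : k.1 ≤ l.1 := hkl; omega)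
      intro k _ l _ e
      rcases le_total k l with hkl | hkl
      · exact key k l hkl fun z hz => congrFun e ⟨z, hz⟩
      · exact (key l k hkl fun z hz => (congrFun e ⟨z, hz⟩).symm).symm
  · suffices hx : ∃ b : Fin q → crossedSubalgebra ι H,
        (x : A) = ∑ k, (b k : A) * ((u ^ k.1 : Aˣ) : A) by
      obtain ⟨b, hb⟩ := hx
      refine ⟨b, Subtype.ext ?_⟩
      rw [hb]
      simp
    obtain ⟨a, ha⟩ := exists_eq_sum_of_mem_crossedSubalgebra ι h H' v hv x.2
    rw [ha]
    refine Finset.sum_induction _ (fun y => ∃ b : Fin q → crossedSubalgebra ι H,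
      y = ∑ k, (b k : A) * ((u ^ k.1 : Aˣ) : A)) ?_ ⟨0, by simp⟩ fun ρ _ => ?_
    · rintro _ _ ⟨b, rfl⟩ ⟨b', rfl⟩
      exact ⟨b + b', by simp [add_mul, Finset.sum_add_distrib]⟩
    · obtain ⟨g, hg, k, hk, hρ⟩ := hrep ρ ρ.2
      -- Since ρ = g s^k, this product induces `g` in H on M, so it is a coefficient of `u ^ k` from
      -- M(H).
      have hmem : (v ρ : A) * ((u ^ k)⁻¹ : Aˣ) ∈ crossedSubalgebra ι H :=
        mem_crossedSubalgebra_of_mul_eq hg fun m => by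
          rw [mul_assoc, units_inv_mul_eq (units_pow_mul_eq hu k), ← mul_assoc, hv, hρ, mul_assoc,
            ← AlgEquiv.mul_apply, mul_inv_cancel_right]
      refine ⟨Pi.single ⟨k, hk⟩ ⟨ι (a ρ) * ((v ρ : A) * ((u ^ k)⁻¹ : Aˣ)),
        Subalgebra.mul_mem _ (apply_mem_crossedSubalgebra ι H _) hmem⟩, ?_⟩
      rw [Finset.sum_eq_single ⟨k, hk⟩ (fun l _ hl => by
        rw [Pi.single_eq_of_ne hl, ZeroMemClass.coe_zero, zero_mul]) (by simp), Pi.single_eq_same]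
      simp only [mul_assoc, Units.inv_mul, mul_one]

/-- Strictness follows from the dimensions |H|·n and |H'|·n. -/
theorem crossedSubalgebra_lt (ι : M →ₐ[F] A)
    (h : Module.finrank F A = Module.finrank F M ^ 2) {H H' : Subgroup (M ≃ₐ[F] M)}
    (hlt : H < H') : crossedSubalgebra ι H < crossedSubalgebra ι H' := by
  refine lt_of_le_of_ne (crossedSubalgebra_mono ι hlt.le) fun heq => hlt.ne ?_
  have h₁ := finrank_crossedSubalgebra ι h H
  rw [heq, finrank_crossedSubalgebra ι h H'] at h₁
  have hpos : 0 < Module.finrank F M := Module.finrank_pos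
  exact Subgroup.eq_of_le_of_card_ge hlt.le (Nat.eq_of_mul_eq_mul_right hpos h₁).le

end Step

theorem mainTheorem9 {F M A : Type*} [Field F] [Field M] [Algebra F M] [Ring A] [Algebra F A]
    (n : ℕ) (hA : IsCentralSimpleOfDegree F A n) (hM : Module.finrank F M = n) (ι : M →ₐ[F] A)
    [Nontrivial (M ≃ₐ[F] M)] (hG : Group.IsSolvable (M ≃ₐ[F] M)) :
    (∃ k : ℕ, Nonempty (PrimeSeries (M ≃ₐ[F] M) k)) ∧
    ∀ (k : ℕ) (S : PrimeSeries (M ≃ₐ[F] M) k)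
      (σ : ∀ i : Fin k, S.H i.succ) (_ : ∀ i : Fin k, S.Generates i (σ i)),
      ∃ B : Fin (k + 1) → Subalgebra F A,
        B 0 = ι.range ∧
        (∀ i : Fin k, B i.castSucc < B i.succ) ∧
        B (Fin.last k) = crossedSubalgebra ι ⊤ ∧
        (∀ i : Fin (k + 1), IsCrossedProductOverFix ι (S.H i) (B i)) ∧
        ∀ i : Fin k, ∃ (τ : B i.castSucc ≃ₐ[F] B i.castSucc) (c : (B i.castSucc)ˣ),
          HasInnerOrder τ (S.q i) ∧
          (∀ (m : M) (b : B i.castSucc), (b : A) = ι m →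
            (τ b : A) = ι ((σ i : M ≃ₐ[F] M) m)) ∧
          τ (c : B i.castSucc) = c ∧
          IsCyclicExtension τ (B i.succ) (S.q i) (c : B i.castSucc) := by
  have : Algebra.IsCentral F A := hA.central
  have : IsSimpleRing A := hA.simple
  have : FiniteDimensional F A := hA.finite
  have : FiniteDimensional F M :=
    FiniteDimensional.of_injective ι.toLinearMap ι.toRingHom.injective
  have h : Module.finrank F A = Module.finrank F M ^ 2 := by rw [hA.finrank_eq, hM]
  refine ⟨exists_primeSeries _, fun k S σ hσ => ⟨fun i => crossedSubalgebra ι (S.H i), ?_,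
    fun i => crossedSubalgebra_lt ι h (S.lt_succ i), ?_,
    fun i => isCrossedProductOverFix_crossedSubalgebra ι h (S.H i), fun i => ?_⟩⟩
  · simp only [S.bot]
    exact crossedSubalgebra_bot ι h
  · simp only [S.top]
  · exact exists_isCyclicExtension_crossedSubalgebra ι h (S.lt_succ i).le (σ i).2 (S.q_pos i)
      (fun g hg => S.conj_mem i (σ i) hg) (fun g hg => S.conj_mem i (σ i)⁻¹ hg)
      (S.pow_mem_iff i (hσ i)) fun g hg => S.exists_eq_mul_pow i (hσ i) hg
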